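/- Let $S$ and $A$ be finite nonempty sets of states and actions, $p^j_{ia}$ transition probabilities, $r^j_{ia}\in\mathbb R$ rewards, and $\gamma\in[0,1)$ a discount factor. For $Q\in\mathbb R^{S\times A}$ put $\mathcal M Q(i)=\max_{b\in A}Q(i,b)$ and, for $w\in(0,w^*]$ with $w^*=\min_{i,a}\frac1{1-\gamma p^i_{ia}}$, let $$(U_wQ)(i,a)=w\Big(\sum_j p^j_{ia}r^j_{ia}+\gamma\sum_j p^j_{ia}\,\mathcal MQ(j)\Big)+(1-w)\,\mathcal MQ(i).$$ Fix such a $w$. Double SOR Q-learning generates tables $Q^A_n,Q^B_n\in\mathbb R^{S\times A}$, $n\ge 0$, as follows. Let $(\mathcal F_n)_{n\ge0}$ be a filtration on a probability space such that $Q^A_0,Q^B_0$ are $\mathcal F_0$-measurable. At step $n$ there are an $\mathcal F_n$-measurable pair $(i_n,a_n)\in S\times A$, $\mathcal F_n$-measurable step sizes $\beta_n(i,a)$, and an $\mathcal F_{n+1}$-measurable next state $j_n$ and coin; conditionally on $\mathcal F_n$, $j_n$ has law $p^{\,\cdot}_{i_na_n}$ and the coin is fair and independent of $j_n$. If the coin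 selects $A$, then $$Q^A_{n+1}(i_n,a_n)=(1-\beta_n)Q^A_n(i_n,a_n)+\beta_n\big[w\big(r^{j_n}_{i_na_n}+\gamma Q^B_n(j_n,b^*)\big)+(1-w)Q^B_n(i_n,c^*)\big],$$ with $\beta_n=\beta_n(i_n,a_n)$, $b^*\in\arg\max_b Q^A_n(j_n,b)$, $c^*\in\arg\max_c Q^A_n(i_n,c)$; otherwise $$Q^B_{n+1}(i_n,a_n)=(1-\beta_n)Q^B_n(i_n,a_n)+\beta_n\big[w\big(r^{j_n}_{i_na_n}+\gamma Q^A_n(j_n,d^*)\big)+(1-w)Q^A_n(i_n,e^*)\big],$$ with $d^*\in\arg\max_d Q_n(j_n,d)$, $e^*\in\arg\max_e Q_n(i_n,e)$, where either $Q_n=Q^B_n$ for all $n$, or $Q_n=Q^A_n$ for all $n$. All other entries of both tables are unchanged. Ties are broken at step $n$ by an $\mathcal F_n$-measurable choice of one maximizer per state (so $b^*=c^*$ and $d^*=e^*$ when $j_n=i_n$). Assume that almost surely: (i) $\|Q^A_n\|_\infty\le B$ and $\|Q^B_n\|_\infty\le B$ for all $n$, for some constant $B<\infty$; (ii) every $(i,a)\in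 S\times A$ equals $(i_n,a_n)$ for infinitely many $n$; (iii) $0\le\beta_n(i,a)\le1$ for all $n,i,a$, and for every $(i,a)$, $\ \sum_{n:(i_n,a_n)=(i,a)}\beta_n(i,a)=\infty$ and $\sum_{n:(i_n,a_n)=(i,a)}\beta_n(i,a)^2<\infty$. Then $U_w$ has a unique fixed point $Q^*_w$, and almost surely $Q^A_n\to Q^*_w$ and $Q^B_n\to Q^*_w$ as $n\to\infty$. -/

import Mathlib

open MeasureTheory Filter Topology

namespace DoubleSOR

/-- A finite Markov decision process with state set `S` and action set `A`: `p i a j` is the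
probability of moving from `i` to `j` under `a`, `r i a j` is the reward received on that
transition, and `γ` is the discount factor. -/
structure FiniteMDP (S A : Type*) [Fintype S] where
  p : S → A → S → ℝ
  r : S → A → S → ℝ
  γ : ℝ
  p_nonneg : ∀ i a j, 0 ≤ p i a j
  p_sum : ∀ i a, ∑ j, p i a j = 1
  γ_nonneg : 0 ≤ γ
  γ_lt_one : γ < 1

section Operator

variable {S A : Type*} [Fintype S] [Fintype A] [Nonempty A]

/-- The max-operator `(ℳ Q)(i) = max_b Q(i, b)`. -/
noncomputable def maxOp (Q : S × A → ℝ) (i : S) : ℝ :=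
  Finset.univ.sup' Finset.univ_nonempty (fun b : A => Q (i, b))

/-- The expected one-step reward `r(i, a) = ∑_j p^j_{ia} r^j_{ia}`. -/
noncomputable def FiniteMDP.meanReward (M : FiniteMDP S A) (i : S) (a : A) : ℝ :=
  ∑ j, M.p i a j * M.r i a j

/-- The modified (successive over-relaxation) Bellman operator `U_w`. -/
noncomputable def FiniteMDP.sorOp (M : FiniteMDP S A) (w : ℝ) (Q : S × A → ℝ) : S × A → ℝ :=
  fun x => w * (M.meanReward x.1 x.2 + M.γ * ∑ j, M.p x.1 x.2 j * maxOp Q j)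
    + (1 - w) * maxOp Q x.1

/-- The largest admissible relaxation factor `w* = min_{i,a} 1 / (1 - γ p^i_{ia})`. -/
noncomputable def FiniteMDP.wStar [Nonempty S] (M : FiniteMDP S A) : ℝ :=
  Finset.univ.inf' Finset.univ_nonempty
    (fun x : S × A => 1 / (1 - M.γ * M.p x.1 x.2 x.1))

end Operator

/-- `g` picks in every state an action that is maximal for the table `Q`. -/
def IsGreedy {S A : Type*} (Q : S × A → ℝ) (g : S → A) : Prop :=
  ∀ s b, Q (s, b) ≤ Q (s, g s)

/-- The table whose maximizers `d*`, `e*` are used when the second table is updated: the second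
table itself (the symmetric, usual form of double Q-learning), or the first table. -/
inductive Selector
  | tableB
  | tableA

/-- The table designated by a `Selector`. -/
def Selector.pick {T : Type*} (σ : Selector) (QA QB : T) : T :=
  match σ with
  | .tableB => QB
  | .tableA => QA

/-- The result of updating the entry `(i, a)` of `Q` from the sample `(i, a, j, r^j_{ia})`, with step
size `b`, evaluating the actions selected by `g` with the other table `Q'`. -/
noncomputable def FiniteMDP.update {S A : Type*} [Fintype S] [DecidableEq S] [DecidableEq A]
    (M : FiniteMDP S A) (w b : ℝ) (Q Q' : S × A → ℝ) (g : S → A) (i : S) (a : A) (j : S) :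
    S × A → ℝ :=
  Function.update Q (i, a)
    ((1 - b) * Q (i, a)
      + b * (w * (M.r i a j + M.γ * Q' (j, g j)) + (1 - w) * Q' (i, g i)))

/-- A run of double SOR Q-learning with constant relaxation factor `w`.

At step `n` the pair `(i n, a n)` is sampled, `j n` is the observed next state, `coin n` decides
which table is updated (`true`: the first one, `QA`), `β n` is the step size, and `gA n`, `gB n`
are the greedy choices, so that `b* = gA n (j n)`, `c* = gA n (i n)`, `d* = gB n (j n)`,
`e* = gB n (i n)`. The σ-algebra `ℱ n` carries the information available just before the next
state and the coin of step `n` are drawn. Nothing is assumed on how the pairs are chosen except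
that the choice does not look into the future; following a trajectory (`i (n + 1) = j n`) with an
arbitrary behaviour policy is one possibility. -/
structure IsDoubleSORQLearning {S A Ω : Type*} [Fintype S]
    [DecidableEq S] [DecidableEq A] [MeasurableSpace S] [MeasurableSpace A]
    {mΩ : MeasurableSpace Ω} (M : FiniteMDP S A) (w : ℝ) (σ : Selector)
    (μ : Measure Ω) (ℱ : Filtration ℕ mΩ)
    (i : ℕ → Ω → S) (a : ℕ → Ω → A) (j : ℕ → Ω → S) (coin : ℕ → Ω → Bool)
    (β : ℕ → Ω → S × A → ℝ) (gA gB : ℕ → Ω → S → A)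
    (QA QB : ℕ → Ω → S × A → ℝ) : Prop where
  measurable_QA_zero : Measurable[ℱ 0] (QA 0)
  measurable_QB_zero : Measurable[ℱ 0] (QB 0)
  measurable_state : ∀ n, Measurable[ℱ n] (i n)
  measurable_action : ∀ n, Measurable[ℱ n] (a n)
  measurable_step : ∀ n, Measurable[ℱ n] (β n)
  measurable_gA : ∀ n, Measurable[ℱ n] (gA n)
  measurable_gB : ∀ n, Measurable[ℱ n] (gB n)
  measurable_next : ∀ n, Measurable[ℱ (n + 1)] (j n)
  measurable_coin : ∀ n, Measurable[ℱ (n + 1)] (coin n)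
  /-- Given the past, the next state has law `p^·_{i_n a_n}` and the coin is fair and independent
  of the next state. -/
  cond_law : ∀ (n : ℕ) (c : Bool) (s : S),
    μ[Set.indicator {ω | coin n ω = c ∧ j n ω = s} (fun _ => (1 : ℝ)) | ℱ n]
      =ᵐ[μ] fun ω => 1 / 2 * M.p (i n ω) (a n ω) s
  greedy_A : ∀ n ω, IsGreedy (QA n ω) (gA n ω)
  greedy_B : ∀ n ω, IsGreedy (σ.pick (QA n ω) (QB n ω)) (gB n ω)
  update_A : ∀ n ω, QA (n + 1) ω =
    if coin n ω = true then
      M.update w (β n ω (i n ω, a n ω)) (QA n ω) (QB n ω) (gA n ω) (i n ω) (a n ω) (j n ω)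
    else QA n ω
  update_B : ∀ n ω, QB (n + 1) ω =
    if coin n ω = true then QB n ω
    else
      M.update w (β n ω (i n ω, a n ω)) (QB n ω) (QA n ω) (gB n ω) (i n ω) (a n ω) (j n ω)

/-- The step size with which the entry `x` is updated at step `n`: it is `β n x` if `x` is the pair
sampled at step `n` and `0` otherwise. -/
noncomputable def effStep {S A Ω : Type*} [DecidableEq S] [DecidableEq A]
    (i : ℕ → Ω → S) (a : ℕ → Ω → A) (β : ℕ → Ω → S × A → ℝ) (x : S × A) (n : ℕ) (ω : Ω) : ℝ :=
  if (i n ω, a n ω) = x then β n ω x else 0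

end DoubleSOR

/-! Write `U_w Q (x) = w r(x) + ∑_j q_j max_b Q(j,b)`. The bound `w ≤ w*` makes all weights `q_j`
nonnegative, and they sum to `κ = 1 - w(1-γ) < 1`, so `U_w` is a sup-norm contraction
(`exists_unique_fixedPt_sorOp`). Because the coin is fair, each table is a relaxation with half the
step size towards its mean target, plus martingale noise (`FollowsUpdate.relaxation`). The tables
are bounded and the steps square summable, so the accumulated noise converges almost surely
(`ae_tendsto_sum_noise`). The rest is pathwise, by two uses of
`tendsto_zero_of_contracting_relaxation`. For `QA - QB` the rewards cancel, and
`abs_cross_evaluation_le` bounds the target by `κ‖QA - QB‖`, so the tables merge. For `QA - Q*` the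
target is at most `κ‖QA - Q*‖ + κ‖QA - QB‖`, a contraction up to a vanishing error. -/

namespace DoubleSOR

/-! ### Deterministic estimates for perturbed relaxations. -/

/-- A relaxation `x ↦ (1 - α) x + α f` with divergent step sizes forgets its starting point: it is
eventually bounded by any number exceeding an eventual bound of the targets `f`. -/
theorem eventually_abs_le_of_relaxation {x f α : ℕ → ℝ} {D : ℝ}
    (hα : ∀ n, 0 ≤ α n ∧ α n ≤ 1)
    (hsum : Tendsto (fun N => ∑ n ∈ Finset.range N, α n) atTop atTop)
    (hx : ∀ n, x (n + 1) = (1 - α n) * x n + α n * f n)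
    (hf : ∀ᶠ n in atTop, |f n| ≤ D) {ε : ℝ} (hε : 0 < ε) :
    ∀ᶠ n in atTop, |x n| ≤ D + ε := by
  obtain ⟨N, hN⟩ := eventually_atTop.1 hf
  set P : ℕ → ℝ := fun n => ∑ k ∈ Finset.range n, α k with hP
  -- The excess over `D` shrinks by `1 - α ≤ exp (-α)` at each step. The absolute value on the right
  -- keeps that factor nonnegative, as the last comparison requires.
  have key : ∀ n, N ≤ n → |x n| - D ≤ Real.exp (-(P n - P N)) * |(|x N| - D)| := by
    intro n hn
    induction n, hn using Nat.le_induction with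
    | base =>
      rw [sub_self, neg_zero, Real.exp_zero, one_mul]
      exact le_abs_self _
    | succ n hn ih =>
      have h1 : |x (n + 1)| ≤ (1 - α n) * |x n| + α n * D := by
        rw [hx]
        refine (abs_add_le _ _).trans ?_
        rw [abs_mul, abs_mul, abs_of_nonneg (sub_nonneg.2 (hα n).2), abs_of_nonneg (hα n).1]
        have := mul_le_mul_of_nonneg_left (hN n hn) (hα n).1
        linarith
      have h2 : P (n + 1) = P n + α n := by simp [hP, Finset.sum_range_succ]
      have h3 : Real.exp (-(P (n + 1) - P N)) = Real.exp (-α n) * Real.exp (-(P n - P N)) := by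
        rw [← Real.exp_add, h2]; congr 1; ring
      have h4 : 1 - α n ≤ Real.exp (-α n) := by linarith [Real.add_one_le_exp (-α n)]
      calc |x (n + 1)| - D ≤ (1 - α n) * (|x n| - D) := by linarith
        _ ≤ (1 - α n) * (Real.exp (-(P n - P N)) * |(|x N| - D)|) :=
          mul_le_mul_of_nonneg_left ih (sub_nonneg.2 (hα n).2)
        _ ≤ Real.exp (-α n) * (Real.exp (-(P n - P N)) * |(|x N| - D)|) :=
          mul_le_mul_of_nonneg_right h4 (by positivity)
        _ = _ := by rw [h3, mul_assoc]
  have hlim : Tendsto (fun n => Real.exp (-(P n - P N)) * |(|x N| - D)|) atTop (𝓝 0) := by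
    have : Tendsto (fun n => -(P n - P N)) atTop atBot :=
      tendsto_neg_atTop_atBot.comp (tendsto_atTop_add_const_right _ (-P N) hsum)
    simpa using (Real.tendsto_exp_atBot.comp this).mul_const (|(|x N| - D)|)
  filter_upwards [hlim.eventually_lt_const hε, eventually_ge_atTop N] with n h1 h2
  linarith [key n h2]

/-- Asynchronous stochastic approximation, pathwise form: if the targets `F` contract in the sup norm
up to a vanishing error `c`, and the noise `u` is summable, then bounded iterates tend to zero. -/
theorem tendsto_zero_of_contracting_relaxation {Y : Type*} [Fintype Y]
    {X F α u : ℕ → Y → ℝ} {c : ℕ → ℝ} {κ B : ℝ} (hκ0 : 0 ≤ κ) (hκ1 : κ < 1)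
    (hα : ∀ n y, 0 ≤ α n y ∧ α n y ≤ 1)
    (hsum : ∀ y, Tendsto (fun N => ∑ n ∈ Finset.range N, α n y) atTop atTop)
    (hX : ∀ n y, X (n + 1) y = X n y + α n y * (F n y - X n y) + u n y)
    (hu : ∀ y, ∃ l, Tendsto (fun N => ∑ n ∈ Finset.range N, u n y) atTop (𝓝 l))
    (hF : ∀ n y, |F n y| ≤ κ * ‖X n‖ + c n) (hc : Tendsto c atTop (𝓝 0))
    (hB : ∀ n, ‖X n‖ ≤ B) :
    Tendsto X atTop (𝓝 0) := by
  choose l hl using hu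
  -- An eventual bound `D` improves to `κ D + ε`. Subtracting the remainder `R → 0` of the noise
  -- series turns `X` into an exact relaxation towards `F - R`.
  have step : ∀ D, 0 ≤ D → (∀ᶠ n in atTop, ‖X n‖ ≤ D) → ∀ ε, 0 < ε →
      ∀ᶠ n in atTop, ‖X n‖ ≤ κ * D + ε := by
    intro D hD hXD ε hε
    have hy : ∀ y, ∀ᶠ n in atTop, |X n y| ≤ κ * D + ε := by
      intro y
      set R : ℕ → ℝ := fun N => ∑ n ∈ Finset.range N, u n y - l y with hR
      have hR0 : Tendsto R atTop (𝓝 0) := by simpa [hR] using (hl y).sub_const (l y)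
      have hRs : ∀ δ, 0 < δ → ∀ᶠ n in atTop, |R n| < δ := fun δ hδ => by
        simpa using hR0.abs.eventually_lt_const (by simpa using hδ)
      have hZ := eventually_abs_le_of_relaxation (x := fun n => X n y - R n)
        (f := fun n => F n y - R n) (α := fun n => α n y) (D := κ * D + ε / 4 + ε / 4)
        (fun n => hα n y) (hsum y)
        (by
          intro n
          have : R (n + 1) = R n + u n y := by simp [hR, Finset.sum_range_succ]; ring
          simp only [this, hX]; ring)
        (by
          filter_upwards [hXD, hRs (ε / 4) (by positivity),
            hc.eventually_lt_const (show 0 < ε / 4 by positivity)] with n h1 h2 h3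
          have h4 := abs_sub (F n y) (R n)
          have h5 := hF n y
          have h6 := mul_le_mul_of_nonneg_left h1 hκ0
          linarith) (show 0 < ε / 4 by positivity)
      filter_upwards [hZ, hRs (ε / 4) (by positivity)] with n h1 h2
      have h3 := abs_add_le (X n y - R n) (R n)
      rw [sub_add_cancel] at h3
      linarith
    filter_upwards [eventually_all.2 hy] with n hn
    exact (pi_norm_le_iff_of_nonneg (by positivity)).2 hn
  have hB0 : 0 ≤ B := (norm_nonneg _).trans (hB 0)
  -- With `ε = (1-κ)/2 · D` the improved bound is `(1+κ)/2 · D`; starting from `B + 1` rather than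
  -- `B` keeps `D`, hence `ε`, positive.
  have iter : ∀ k : ℕ, ∀ᶠ n in atTop, ‖X n‖ ≤ ((1 + κ) / 2) ^ k * (B + 1) := by
    intro k
    induction k with
    | zero => exact Eventually.of_forall fun n => by simpa using (hB n).trans (by linarith)
    | succ k ih =>
      have hpos : 0 < ((1 + κ) / 2) ^ k * (B + 1) := by positivity
      filter_upwards [step _ hpos.le ih ((1 - κ) / 2 * (((1 + κ) / 2) ^ k * (B + 1)))
        (mul_pos (by linarith) hpos)] with n hn
      refine hn.trans (le_of_eq ?_)
      ring
  rw [tendsto_zero_iff_norm_tendsto_zero, Metric.tendsto_atTop]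
  intro ε hε
  have hpow : Tendsto (fun k : ℕ => ((1 + κ) / 2) ^ k * (B + 1)) atTop (𝓝 0) := by
    simpa using (tendsto_pow_atTop_nhds_zero_of_lt_one (by linarith) (by linarith)).mul_const (B + 1)
  obtain ⟨k, hk⟩ := (hpow.eventually_lt_const hε).exists
  obtain ⟨N, hN⟩ := eventually_atTop.1 (iter k)
  exact ⟨N, fun n hn => by simpa using (hN n hn).trans_lt hk⟩

/-! ### Almost sure convergence of martingale transforms. -/

/-- A martingale transform of bounded martingale differences by predictable weights whose squares
have a bounded sum converges almost surely. -/
theorem ae_tendsto_sum_of_sum_sq_le {Ω : Type*} {mΩ : MeasurableSpace Ω} {μ : Measure Ω}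
    [IsProbabilityMeasure μ] {ℱ : Filtration ℕ mΩ} {η d : ℕ → Ω → ℝ} {C : ℝ}
    (hη : ∀ n, Measurable[ℱ n] (η n)) (hd : ∀ n, Measurable[ℱ (n + 1)] (d n))
    (hd1 : ∀ n ω, |d n ω| ≤ 1) (hd0 : ∀ n, μ[d n | ℱ n] =ᵐ[μ] 0)
    (hC : ∀ n ω, ∑ k ∈ Finset.range n, η k ω ^ 2 ≤ C) :
    ∀ᵐ ω ∂μ, ∃ l, Tendsto (fun N => ∑ n ∈ Finset.range N, η n ω * d n ω) atTop (𝓝 l) := by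
  obtain ⟨ω₀⟩ := μ.nonempty_of_neZero
  have hC0 : 0 ≤ C := by simpa using hC 0 ω₀
  have hηb : ∀ n ω, |η n ω| ≤ C + 1 := by
    intro n ω
    have h1 := hC (n + 1) ω
    rw [Finset.sum_range_succ] at h1
    have h2 : 0 ≤ ∑ k ∈ Finset.range n, η k ω ^ 2 := Finset.sum_nonneg fun _ _ => sq_nonneg _
    have h3 := sq_abs (η n ω)
    nlinarith [sq_nonneg (|η n ω| - 1), abs_nonneg (η n ω)]
  have htb : ∀ n ω, |η n ω * d n ω| ≤ C + 1 := by
    intro n ω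
    rw [abs_mul]
    calc _ ≤ (C + 1) * 1 := mul_le_mul (hηb n ω) (hd1 n ω) (abs_nonneg _) (by positivity)
      _ = _ := mul_one _
  set m : ℕ → Ω → ℝ := fun N ω => ∑ n ∈ Finset.range N, η n ω * d n ω with hm
  have hmm : ∀ N, Measurable[ℱ N] (m N) := fun N =>
    Finset.measurable_sum _ fun n hn =>
      ((hη n).mono (ℱ.mono (Finset.mem_range.1 hn).le) le_rfl).mul
        ((hd n).mono (ℱ.mono (Finset.mem_range.1 hn)) le_rfl)
  have hmb : ∀ N ω, |m N ω| ≤ N * (C + 1) := by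
    intro N ω
    refine (Finset.abs_sum_le_sum_abs _ _).trans ((Finset.sum_le_sum fun n _ => htb n ω).trans (le_of_eq ?_))
    simp only [Finset.sum_const, Finset.card_range, nsmul_eq_mul]
  have hη' : ∀ n, Measurable (η n) := fun n => (hη n).mono (ℱ.le n) le_rfl
  have hd' : ∀ n, Measurable (d n) := fun n => (hd n).mono (ℱ.le _) le_rfl
  have hm' : ∀ n, Measurable (m n) := fun n => (hmm n).mono (ℱ.le n) le_rfl
  have hint : ∀ {f : Ω → ℝ} {b : ℝ}, Measurable f → (∀ ω, |f ω| ≤ b) → Integrable f μ :=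
    fun hf hb => Integrable.of_bound hf.aestronglyMeasurable _ (Eventually.of_forall hb)
  have hdi : ∀ n, Integrable (d n) μ := fun n => hint (hd' n) (hd1 n)
  have hmi : ∀ n, Integrable (m n) μ := fun n => hint (hm' n) (hmb n)
  have hce : ∀ n (f : Ω → ℝ) (b : ℝ), Measurable[ℱ n] f → (∀ ω, |f ω| ≤ b) →
      μ[f * d n | ℱ n] =ᵐ[μ] 0 := by
    intro n f b hf hb
    have hi : Integrable (f * d n) μ :=
      (hdi n).bdd_mul (hf.mono (ℱ.le n) le_rfl).aestronglyMeasurable (Eventually.of_forall hb)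
    filter_upwards [condExp_mul_of_stronglyMeasurable_left (m := ℱ n) hf.stronglyMeasurable hi
      (hdi n), hd0 n] with ω h1 h2
    simp [h1, h2]
  have hmart : Martingale m ℱ μ := by
    refine martingale_of_condExp_sub_eq_zero_nat (fun n => (hmm n).stronglyMeasurable) hmi ?_
    intro n
    have : m (n + 1) - m n = η n * d n := by
      ext ω; simp [hm, Finset.sum_range_succ]
    rw [this]
    exact hce n _ _ (hη n) (hηb n)
  have hsqi : ∀ n, Integrable (fun ω => m n ω ^ 2) μ := fun n =>
    hint (b := (n * (C + 1)) ^ 2) ((hm' n).pow_const 2) fun ω => by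
      rw [abs_pow]; exact pow_le_pow_left₀ (abs_nonneg _) (hmb n ω) 2
  have hηi : ∀ n, Integrable (fun ω => ∑ k ∈ Finset.range n, η k ω ^ 2) μ := fun n =>
    hint (b := C) (Finset.measurable_sum _ fun k _ => (hη' k).pow_const 2) fun ω => by
      rw [abs_of_nonneg (Finset.sum_nonneg fun _ _ => sq_nonneg _)]; exact hC n ω
  -- Orthogonality of increments: the cross term has mean zero and `d² ≤ 1`.
  have hsq : ∀ n, ∫ ω, m n ω ^ 2 ∂μ ≤ ∫ ω, ∑ k ∈ Finset.range n, η k ω ^ 2 ∂μ := by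
    intro n
    induction n with
    | zero => simp [hm]
    | succ n ih =>
      have hcb : ∀ ω, |(2 * m n ω * η n ω)| ≤ 2 * (n * (C + 1)) * (C + 1) := fun ω => by
        rw [abs_mul, abs_mul, abs_two]
        have := hmb n ω
        have := hηb n ω
        gcongr
      have hcm : Measurable[ℱ n] (fun ω => 2 * m n ω * η n ω) := ((hmm n).const_mul 2).mul (hη n)
      have hci : Integrable (fun ω => 2 * m n ω * η n ω * d n ω) μ :=
        (hdi n).bdd_mul (hcm.mono (ℱ.le n) le_rfl).aestronglyMeasurable (Eventually.of_forall hcb)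
      have hcz : ∫ ω, 2 * m n ω * η n ω * d n ω ∂μ = 0 := by
        have h := integral_condExp (μ := μ) (f := (fun ω => 2 * m n ω * η n ω) * d n) (ℱ.le n)
        rw [integral_congr_ae (hce n _ _ hcm hcb)] at h
        simpa using h.symm
      have hei : Integrable (fun ω => η n ω ^ 2) μ :=
        hint (b := (C + 1) ^ 2) ((hη' n).pow_const 2) fun ω => by
          rw [abs_pow]; exact pow_le_pow_left₀ (abs_nonneg _) (hηb n ω) 2
      have hle : ∀ ω, m (n + 1) ω ^ 2 ≤ m n ω ^ 2 + 2 * m n ω * η n ω * d n ω + η n ω ^ 2 := by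
        intro ω
        have h1 : m (n + 1) ω = m n ω + η n ω * d n ω := by simp [hm, Finset.sum_range_succ]
        have h2 : d n ω ^ 2 ≤ 1 := (sq_le_one_iff_abs_le_one _).2 (hd1 n ω)
        rw [h1]
        nlinarith [mul_le_mul_of_nonneg_left h2 (sq_nonneg (η n ω))]
      calc ∫ ω, m (n + 1) ω ^ 2 ∂μ
          ≤ ∫ ω, (m n ω ^ 2 + 2 * m n ω * η n ω * d n ω + η n ω ^ 2) ∂μ :=
            integral_mono (hsqi _) (((hsqi n).add hci).add hei) hle
        _ = ∫ ω, m n ω ^ 2 ∂μ + ∫ ω, η n ω ^ 2 ∂μ := by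
            have hi : Integrable (fun ω => m n ω ^ 2 + 2 * m n ω * η n ω * d n ω) μ :=
              (hsqi n).add hci
            rw [integral_add hi hei, integral_add (hsqi n) hci, hcz, add_zero]
        _ ≤ ∫ ω, ∑ k ∈ Finset.range n, η k ω ^ 2 ∂μ + ∫ ω, η n ω ^ 2 ∂μ := by gcongr
        _ = _ := by rw [← integral_add (hηi n) hei]; simp only [Finset.sum_range_succ]
  -- The second-moment bound gives an `L¹` bound through `|t| ≤ 1 + t²`, which is what the
  -- martingale convergence theorem needs.
  have hL1 : ∀ n, eLpNorm (m n) 1 μ ≤ (Real.toNNReal (1 + C) : NNReal) := by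
    intro n
    rw [eLpNorm_one_eq_lintegral_enorm, ← ofReal_integral_norm_eq_lintegral_enorm (hmi n)]
    refine ENNReal.ofReal_le_ofReal ?_
    calc ∫ ω, ‖m n ω‖ ∂μ ≤ ∫ ω, (1 + m n ω ^ 2) ∂μ :=
          integral_mono (hmi n).norm ((integrable_const 1).add (hsqi n)) fun ω => by
            have := sq_abs (m n ω)
            simp only [Real.norm_eq_abs]
            nlinarith [sq_nonneg (|m n ω| - 1)]
      _ = 1 + ∫ ω, m n ω ^ 2 ∂μ := by
          rw [integral_add (integrable_const 1) (hsqi n)]; simp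
      _ ≤ 1 + ∫ ω, C ∂μ := by
          refine add_le_add_right ?_ 1
          exact (hsq n).trans (integral_mono (hηi n) (integrable_const C) (hC n))
      _ = 1 + C := by simp
  exact hmart.submartingale.exists_ae_tendsto_of_bdd hL1

/-- A martingale transform of bounded martingale differences by predictable weights converges almost
surely if the weights are almost surely square summable. -/
theorem ae_tendsto_sum_of_summable_sq {Ω : Type*} {mΩ : MeasurableSpace Ω} {μ : Measure Ω}
    [IsProbabilityMeasure μ] {ℱ : Filtration ℕ mΩ} {θ d : ℕ → Ω → ℝ}
    (hθ : ∀ n, Measurable[ℱ n] (θ n)) (hd : ∀ n, Measurable[ℱ (n + 1)] (d n))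
    (hd1 : ∀ n ω, |d n ω| ≤ 1) (hd0 : ∀ n, μ[d n | ℱ n] =ᵐ[μ] 0)
    (hsq : ∀ᵐ ω ∂μ, Summable fun n => θ n ω ^ 2) :
    ∀ᵐ ω ∂μ, ∃ l, Tendsto (fun N => ∑ n ∈ Finset.range N, θ n ω * d n ω) atTop (𝓝 l) := by
  classical
  set V : ℕ → Ω → ℝ := fun n ω => ∑ k ∈ Finset.range n, θ k ω ^ 2 with hV
  have hVm : ∀ n, Measurable[ℱ n] (V (n + 1)) := fun n =>
    Finset.measurable_sum _ fun k hk =>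
      ((hθ k).mono (ℱ.mono (Nat.lt_succ_iff.1 (Finset.mem_range.1 hk))) le_rfl).pow_const 2
  -- Weights are switched off once the square sum would exceed `C`. Since `V (n + 1)` involves only
  -- `θ 0, …, θ n`, the truncated weights stay predictable.
  have hconv : ∀ C : ℕ, ∀ᵐ ω ∂μ, ∃ l, Tendsto (fun N => ∑ n ∈ Finset.range N,
      (if V (n + 1) ω ≤ C then θ n ω else 0) * d n ω) atTop (𝓝 l) := by
    intro C
    refine ae_tendsto_sum_of_sum_sq_le (ℱ := ℱ) (C := C) (fun n => ?_) hd hd1 hd0 ?_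
    · exact Measurable.ite (measurableSet_le (hVm n) measurable_const) (hθ n) measurable_const
    · intro n ω
      have haux : ∀ n, ∑ k ∈ Finset.range n, (if V (k + 1) ω ≤ C then θ k ω else 0) ^ 2 ≤ V n ω :=
        fun n => Finset.sum_le_sum fun k _ => by
          split_ifs
          · exact le_rfl
          · simpa using sq_nonneg (θ k ω)
      induction n with
      | zero => simp
      | succ n ih =>
        by_cases h : V (n + 1) ω ≤ C
        · exact (haux (n + 1)).trans h
        · rw [Finset.sum_range_succ, if_neg h]
          simpa using ih
  filter_upwards [ae_all_iff.2 hconv, hsq] with ω h1 h2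
  -- On a given path some integer `C` dominates the whole series, so this truncation never acts;
  -- integer levels keep the exceptional set null.
  obtain ⟨C, hC⟩ := exists_nat_ge (∑' n, θ n ω ^ 2)
  obtain ⟨l, hl⟩ := h1 C
  refine ⟨l, hl.congr fun N => Finset.sum_congr rfl fun n _ => ?_⟩
  rw [if_pos ((h2.sum_le_tsum _ fun _ _ => sq_nonneg _).trans hC)]

/-! ### The relaxed operator as a nonnegatively weighted sum. -/

theorem FiniteMDP.p_le_one {S A : Type*} [Fintype S] (M : FiniteMDP S A) (i : S) (a : A)
    (j : S) : M.p i a j ≤ 1 := by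
  rw [← M.p_sum i a]
  exact Finset.single_le_sum (fun s _ => M.p_nonneg i a s) (Finset.mem_univ j)

section Weights

variable {S A : Type*} [Fintype S] [DecidableEq S]

/-- The nonnegative weights `q` with `U_w Q = w r + ∑_j q_j max_b Q(j, b)`. -/
noncomputable def FiniteMDP.weight (M : FiniteMDP S A) (w : ℝ) (x : S × A) (j : S) : ℝ :=
  w * M.γ * M.p x.1 x.2 j + (1 - w) * (if j = x.1 then 1 else 0)

/-- The sampled target of the entry `x` when the next state is `s`. -/
noncomputable def FiniteMDP.target (M : FiniteMDP S A) (w : ℝ) (g : S → A) (Q : S × A → ℝ)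
    (x : S × A) (s : S) : ℝ :=
  w * (M.r x.1 x.2 s + M.γ * Q (s, g s)) + (1 - w) * Q (x.1, g x.1)

/-- Only the diagonal is delicate, as `1 - w` may be negative: there the weight is `1 - w(1 - γ p)`,
nonnegative by `w ≤ w*`. -/
theorem FiniteMDP.weight_nonneg [Nonempty S] [Fintype A] [Nonempty A] (M : FiniteMDP S A) {w : ℝ}
    (hw : 0 < w) (hw_le : w ≤ M.wStar) (x : S × A) (j : S) : 0 ≤ M.weight w x j := by
  have hp := M.p_nonneg x.1 x.2 j
  have hγ := M.γ_nonneg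
  unfold FiniteMDP.weight
  split_ifs with h
  · subst h
    have h1 : M.γ * M.p x.1 x.2 x.1 < 1 :=
      (mul_le_of_le_one_right hγ (M.p_le_one _ _ _)).trans_lt M.γ_lt_one
    have h2 : w ≤ 1 / (1 - M.γ * M.p x.1 x.2 x.1) :=
      hw_le.trans (Finset.inf'_le (fun x : S × A => 1 / (1 - M.γ * M.p x.1 x.2 x.1))
        (Finset.mem_univ x))
    rw [le_div_iff₀ (by linarith)] at h2
    linarith
  · simp only [mul_zero, add_zero]
    positivity

theorem FiniteMDP.weight_sum (M : FiniteMDP S A) (w : ℝ) (x : S × A) :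
    ∑ j, M.weight w x j = 1 - w * (1 - M.γ) := by
  simp only [FiniteMDP.weight, Finset.sum_add_distrib, ← Finset.mul_sum, M.p_sum]
  simp only [Finset.sum_ite_eq', Finset.mem_univ, if_true]
  ring

theorem FiniteMDP.sum_weight_mul (M : FiniteMDP S A) (w : ℝ) (x : S × A) (f : S → ℝ) :
    ∑ j, M.weight w x j * f j = w * (M.γ * ∑ j, M.p x.1 x.2 j * f j) + (1 - w) * f x.1 := by
  simp only [FiniteMDP.weight, add_mul, Finset.sum_add_distrib, Finset.mul_sum]
  congr 1
  · exact Finset.sum_congr rfl fun j _ => by ring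
  · simp

/-- The common source of the factor `κ`: it serves the fixed point, the difference of the tables and
the error. -/
theorem FiniteMDP.abs_sum_weight_mul_le [Nonempty S] [Fintype A] [Nonempty A] (M : FiniteMDP S A)
    {w : ℝ} (hw : 0 < w) (hw_le : w ≤ M.wStar) (x : S × A) {f : S → ℝ} {b : ℝ}
    (hf : ∀ j, |f j| ≤ b) :
    |∑ j, M.weight w x j * f j| ≤ (1 - w * (1 - M.γ)) * b := by
  rw [← M.weight_sum w x, Finset.sum_mul]
  refine (Finset.abs_sum_le_sum_abs _ _).trans (Finset.sum_le_sum fun j _ => ?_)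
  rw [abs_mul, abs_of_nonneg (M.weight_nonneg hw hw_le x j)]
  exact mul_le_mul_of_nonneg_left (hf j) (M.weight_nonneg hw hw_le x j)

/-- The mean target has the shape of `sorOp_eq`, with the value at the selected action in place of
the maximum. -/
theorem FiniteMDP.sum_p_mul_target (M : FiniteMDP S A) (w : ℝ) (g : S → A) (Q : S × A → ℝ)
    (x : S × A) :
    ∑ s, M.p x.1 x.2 s * M.target w g Q x s
      = w * M.meanReward x.1 x.2 + ∑ j, M.weight w x j * Q (j, g j) := by
  rw [M.sum_weight_mul w x (fun j => Q (j, g j))]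
  have h : ∀ s, M.p x.1 x.2 s * M.target w g Q x s
      = w * (M.p x.1 x.2 s * M.r x.1 x.2 s) + w * (M.γ * (M.p x.1 x.2 s * Q (s, g s)))
        + M.p x.1 x.2 s * ((1 - w) * Q (x.1, g x.1)) := fun s => by
    unfold FiniteMDP.target; ring
  simp only [h, Finset.sum_add_distrib, ← Finset.mul_sum, ← Finset.sum_mul, M.p_sum,
    FiniteMDP.meanReward]
  ring

theorem FiniteMDP.sorOp_eq [Fintype A] [Nonempty A] (M : FiniteMDP S A) (w : ℝ) (Q : S × A → ℝ)
    (x : S × A) :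
    M.sorOp w Q x = w * M.meanReward x.1 x.2 + ∑ j, M.weight w x j * maxOp Q j := by
  rw [M.sum_weight_mul]
  unfold FiniteMDP.sorOp
  ring

end Weights

/-! ### Greedy evaluation and sup-norm contraction. -/

theorem IsGreedy.maxOp_eq {S A : Type*} [Fintype A] [Nonempty A] {Q : S × A → ℝ}
    {g : S → A} (h : IsGreedy Q g) (s : S) :
    maxOp Q s = Q (s, g s) :=
  le_antisymm (Finset.sup'_le _ _ fun b _ => h s b)
    (Finset.le_sup' (fun b => Q (s, b)) (Finset.mem_univ (g s)))

theorem abs_sub_apply_le {X : Type*} [Fintype X] (Q R : X → ℝ) (x : X) : |Q x - R x| ≤ ‖Q - R‖ :=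
  norm_le_pi_norm (Q - R) x

/-- Evaluating each table at the actions selected for the other update differs by at most the
distance of the tables. -/
theorem abs_cross_evaluation_le {S A : Type*} [Fintype S] [Fintype A]
    {QA QB : S × A → ℝ} {gA gB : S → A} {σ : Selector}
    (hA : IsGreedy QA gA) (hB : IsGreedy (σ.pick QA QB) gB) (s : S) :
    |QB (s, gA s) - QA (s, gB s)| ≤ ‖QA - QB‖ := by
  have h1 := abs_le.1 (abs_sub_apply_le QA QB (s, gA s))
  have h2 := abs_le.1 (abs_sub_apply_le QA QB (s, gB s))
  have h3 := hA s (gB s)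
  -- For `tableB`, swapping one selected action gives each one-sided bound. For `tableA`, both
  -- actions maximize `QA`, so `QA` takes the same value at them.
  cases σ with
  | tableB =>
    have h4 : QB (s, gA s) ≤ QB (s, gB s) := hB s (gA s)
    exact abs_le.2 ⟨by linarith, by linarith⟩
  | tableA =>
    have h4 : QA (s, gA s) ≤ QA (s, gB s) := hB s (gA s)
    exact abs_le.2 ⟨by linarith, by linarith⟩

section Contraction

variable {S A : Type*} [Fintype S] [Fintype A] [Nonempty A]

theorem abs_maxOp_sub_le (Q Q' : S × A → ℝ) (s : S) : |maxOp Q s - maxOp Q' s| ≤ ‖Q - Q'‖ := by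
  have key : ∀ Q Q' : S × A → ℝ, maxOp Q s ≤ maxOp Q' s + ‖Q - Q'‖ := fun Q Q' =>
    Finset.sup'_le _ _ fun b _ => by
      have h1 := (abs_le.1 (abs_sub_apply_le Q Q' (s, b))).2
      have h2 : Q' (s, b) ≤ maxOp Q' s :=
        Finset.le_sup' (fun b => Q' (s, b)) (Finset.mem_univ b)
      linarith
  have h1 := key Q Q'
  have h2 := key Q' Q
  rw [norm_sub_rev] at h2
  exact abs_le.2 ⟨by linarith, by linarith⟩

theorem FiniteMDP.contraction_factor [Nonempty S] [DecidableEq S] (M : FiniteMDP S A) {w : ℝ}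
    (hw : 0 < w) (hw_le : w ≤ M.wStar) :
    0 ≤ 1 - w * (1 - M.γ) ∧ 1 - w * (1 - M.γ) < 1 := by
  constructor
  · rw [← M.weight_sum w (Classical.arbitrary (S × A))]
    exact Finset.sum_nonneg fun j _ => M.weight_nonneg hw hw_le _ j
  · have := mul_pos hw (sub_pos.2 M.γ_lt_one)
    linarith

/-- The relaxed Bellman operator has a unique fixed point. -/
theorem FiniteMDP.exists_unique_fixedPt_sorOp [Nonempty S] [DecidableEq S] (M : FiniteMDP S A)
    {w : ℝ} (hw : 0 < w) (hw_le : w ≤ M.wStar) :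
    ∃ Qstar : S × A → ℝ, Function.IsFixedPt (M.sorOp w) Qstar ∧
      ∀ Q, Function.IsFixedPt (M.sorOp w) Q → Q = Qstar := by
  obtain ⟨hκ0, hκ1⟩ := M.contraction_factor hw hw_le
  have hc : ContractingWith ⟨1 - w * (1 - M.γ), hκ0⟩ (M.sorOp w) := by
    refine ⟨by exact_mod_cast hκ1, LipschitzWith.of_dist_le_mul fun Q Q' => ?_⟩
    refine (dist_pi_le_iff (mul_nonneg hκ0 dist_nonneg)).2 fun x => ?_
    rw [Real.dist_eq, M.sorOp_eq, M.sorOp_eq, add_sub_add_left_eq_sub, ← Finset.sum_sub_distrib]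
    simp only [← mul_sub]
    rw [dist_eq_norm]
    exact M.abs_sum_weight_mul_le hw hw_le x fun j => abs_maxOp_sub_le Q Q' j
  exact ⟨ContractingWith.fixedPoint _ hc, hc.fixedPoint_isFixedPt, fun Q hQ => hc.fixedPoint_unique hQ⟩

end Contraction

/-! ### Measurability of the sampled quantities. -/

theorem measurable_apply_selected {S A Ω : Type*} [Fintype A] [DecidableEq A]
    [MeasurableSpace A] [DiscreteMeasurableSpace A] {m : MeasurableSpace Ω}
    {Q : Ω → S × A → ℝ} {g : Ω → S → A}
    (hQ : Measurable Q) (hg : Measurable g) (s : S) : Measurable fun ω => Q ω (s, g ω s) := by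
  -- The random index is removed by splitting over its finitely many values.
  have h : (fun ω => Q ω (s, g ω s)) = fun ω => ∑ b, if g ω s = b then Q ω (s, b) else 0 := by
    ext ω; simp
  rw [h]
  refine Finset.measurable_sum _ fun b _ => Measurable.ite ?_ (measurable_pi_iff.1 hQ _)
    measurable_const
  exact measurable_pi_iff.1 hg s (MeasurableSet.of_discrete (s := {b}))

theorem measurableSet_outcome {S Ω : Type*} [MeasurableSpace S] [DiscreteMeasurableSpace S]
    {m : MeasurableSpace Ω} {j : Ω → S} {coin : Ω → Bool} (hj : Measurable j)
    (hcoin : Measurable coin) (c : Bool) (s : S) :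
    MeasurableSet {ω | coin ω = c ∧ j ω = s} :=
  (hcoin (MeasurableSet.of_discrete (s := {c}))).inter (hj (MeasurableSet.of_discrete (s := {s})))

theorem measurable_p_sampled {S A Ω : Type*} [Fintype S] [MeasurableSpace S]
    [DiscreteMeasurableSpace S] [Fintype A] [MeasurableSpace A] [DiscreteMeasurableSpace A]
    {M : FiniteMDP S A} {m : MeasurableSpace Ω} {i : Ω → S} {a : Ω → A} (hi : Measurable i)
    (ha : Measurable a) (s : S) : Measurable fun ω => 1 / 2 * M.p (i ω) (a ω) s :=
  ((Measurable.of_discrete (f := fun z : S × A => M.p z.1 z.2 s)).comp (hi.prodMk ha)).const_mul _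

theorem measurable_target {S A Ω : Type*} [Fintype S] [Fintype A] [DecidableEq A]
    [MeasurableSpace A] [DiscreteMeasurableSpace A] {M : FiniteMDP S A} {w : ℝ}
    {m : MeasurableSpace Ω} {Q : Ω → S × A → ℝ} {g : Ω → S → A}
    (hQ : Measurable Q) (hg : Measurable g) (x : S × A) (s : S) :
    Measurable fun ω => M.target w (g ω) (Q ω) x s :=
  ((((measurable_apply_selected hQ hg s).const_mul _).const_add _).const_mul _).add
    ((measurable_apply_selected hQ hg x.1).const_mul _)

/-! ### Noise decomposition for one table. -/

section Table

variable {S A Ω : Type*} [Fintype S] [DecidableEq S] [DecidableEq A]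

/-- The centred indicator of the event that the coin shows `c` and the next state is `s`. -/
noncomputable def FiniteMDP.centredOutcome (M : FiniteMDP S A) (i : ℕ → Ω → S) (a : ℕ → Ω → A)
    (j : ℕ → Ω → S) (coin : ℕ → Ω → Bool) (c : Bool) (s : S) (n : ℕ) (ω : Ω) : ℝ :=
  Set.indicator {ω | coin n ω = c ∧ j n ω = s} (fun _ => (1 : ℝ)) ω
    - 1 / 2 * M.p (i n ω) (a n ω) s

/-- The martingale difference in the update of the entry `x` of a table. -/
noncomputable def FiniteMDP.noise (M : FiniteMDP S A) (w : ℝ) (i : ℕ → Ω → S) (a : ℕ → Ω → A)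
    (j : ℕ → Ω → S) (coin : ℕ → Ω → Bool) (β : ℕ → Ω → S × A → ℝ) (c : Bool)
    (g : ℕ → Ω → S → A) (Q Q' : ℕ → Ω → S × A → ℝ) (x : S × A) (n : ℕ) (ω : Ω) : ℝ :=
  ∑ s, effStep i a β x n ω * (M.target w (g n ω) (Q' n ω) x s - Q n ω x)
    * M.centredOutcome i a j coin c s n ω

/-- One table of the algorithm follows the update rule with the coin face `c`. -/
def FiniteMDP.FollowsUpdate (M : FiniteMDP S A) (w : ℝ) (i : ℕ → Ω → S) (a : ℕ → Ω → A)
    (j : ℕ → Ω → S) (coin : ℕ → Ω → Bool) (β : ℕ → Ω → S × A → ℝ) (c : Bool)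
    (g : ℕ → Ω → S → A) (Q Q' : ℕ → Ω → S × A → ℝ) : Prop :=
  ∀ n ω, Q (n + 1) ω = if coin n ω = c then
    M.update w (β n ω (i n ω, a n ω)) (Q n ω) (Q' n ω) (g n ω) (i n ω) (a n ω) (j n ω) else Q n ω

variable {M : FiniteMDP S A} {w : ℝ} {i : ℕ → Ω → S} {a : ℕ → Ω → A} {j : ℕ → Ω → S}
  {coin : ℕ → Ω → Bool} {β : ℕ → Ω → S × A → ℝ} {c : Bool} {g : ℕ → Ω → S → A}
  {Q Q' : ℕ → Ω → S × A → ℝ}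

/-- Expanding over the possible next states separates coefficients known at time `n` from the
outcome indicators; a zero effective step covers the entries not sampled. -/
theorem FiniteMDP.FollowsUpdate.entry (h : M.FollowsUpdate w i a j coin β c g Q Q') (n : ℕ) (ω : Ω)
    (x : S × A) :
    Q (n + 1) ω x = Q n ω x
      + ∑ s, effStep i a β x n ω * (M.target w (g n ω) (Q' n ω) x s - Q n ω x)
        * Set.indicator {ω | coin n ω = c ∧ j n ω = s} (fun _ => (1 : ℝ)) ω := by
  rw [h n ω]
  by_cases hc : coin n ω = c
  · simp only [Set.indicator_apply, Set.mem_ofPred_eq, hc, true_and, mul_ite, mul_one, mul_zero,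
      Finset.sum_ite_eq, Finset.mem_univ, if_true]
    by_cases hx : (i n ω, a n ω) = x
    · subst hx
      simp only [FiniteMDP.update, effStep, FiniteMDP.target, Function.update_self, if_true]
      ring
    · simp [FiniteMDP.update, effStep, hx, Function.update_of_ne (Ne.symm hx)]
  · simp [hc]

/-- An update is a relaxation with half the step size towards the mean target, up to noise. -/
theorem FiniteMDP.FollowsUpdate.relaxation (h : M.FollowsUpdate w i a j coin β c g Q Q') (n : ℕ)
    (ω : Ω) (x : S × A) :
    Q (n + 1) ω x = Q n ω x + effStep i a β x n ω / 2
        * (w * M.meanReward x.1 x.2 + ∑ s, M.weight w x s * Q' n ω (s, g n ω s) - Q n ω x)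
      + M.noise w i a j coin β c g Q Q' x n ω := by
  rw [h.entry n ω x, ← M.sum_p_mul_target w (g n ω) (Q' n ω) x, FiniteMDP.noise]
  -- The compensator in `centredOutcome` uses the sampled pair, which is `x` whenever the step is
  -- nonzero.
  by_cases hx : (i n ω, a n ω) = x
  · subst hx
    simp only [FiniteMDP.centredOutcome, mul_sub (effStep _ _ _ _ _ _ * _), Finset.sum_sub_distrib]
    have h1 : ∑ s, effStep i a β (i n ω, a n ω) n ω
          * (M.target w (g n ω) (Q' n ω) (i n ω, a n ω) s - Q n ω (i n ω, a n ω))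
          * (1 / 2 * M.p (i n ω) (a n ω) s)
        = effStep i a β (i n ω, a n ω) n ω / 2
          * (∑ s, M.p (i n ω) (a n ω) s * M.target w (g n ω) (Q' n ω) (i n ω, a n ω) s
            - (∑ s, M.p (i n ω) (a n ω) s) * Q n ω (i n ω, a n ω)) := by
      rw [Finset.sum_mul, ← Finset.sum_sub_distrib, Finset.mul_sum]
      exact Finset.sum_congr rfl fun s _ => by ring
    rw [h1, M.p_sum]
    ring
  · simp [effStep, hx]

variable [MeasurableSpace S] [DiscreteMeasurableSpace S] [Fintype A] [MeasurableSpace A]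
  [DiscreteMeasurableSpace A]

theorem measurable_effStep {m : MeasurableSpace Ω} {n : ℕ} (hi : Measurable (i n))
    (ha : Measurable (a n)) (hβ : Measurable (β n)) (x : S × A) :
    Measurable (effStep i a β x n) :=
  Measurable.ite ((hi.prodMk ha) (MeasurableSet.of_discrete (s := {x}))) (measurable_pi_iff.1 hβ x)
    measurable_const

/-- The accumulated noise of a bounded table converges almost surely. -/
theorem ae_tendsto_sum_noise {mΩ : MeasurableSpace Ω} {μ : Measure Ω} [IsProbabilityMeasure μ]
    {ℱ : Filtration ℕ mΩ}
    (hi : ∀ n, Measurable[ℱ n] (i n)) (ha : ∀ n, Measurable[ℱ n] (a n))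
    (hβ : ∀ n, Measurable[ℱ n] (β n)) (hg : ∀ n, Measurable[ℱ n] (g n))
    (hj : ∀ n, Measurable[ℱ (n + 1)] (j n)) (hcoin : ∀ n, Measurable[ℱ (n + 1)] (coin n))
    (hQ : ∀ n, Measurable[ℱ n] (Q n)) (hQ' : ∀ n, Measurable[ℱ n] (Q' n))
    (hlaw : ∀ n s, μ[Set.indicator {ω | coin n ω = c ∧ j n ω = s} (fun _ => (1 : ℝ)) | ℱ n]
      =ᵐ[μ] fun ω => 1 / 2 * M.p (i n ω) (a n ω) s)
    {B : ℝ} (hB : ∀ᵐ ω ∂μ, ∀ n, ‖Q n ω‖ ≤ B ∧ ‖Q' n ω‖ ≤ B)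
    (hsq : ∀ᵐ ω ∂μ, ∀ x, Summable fun n => effStep i a β x n ω ^ 2) :
    ∀ᵐ ω ∂μ, ∀ x, ∃ l, Tendsto
      (fun N => ∑ n ∈ Finset.range N, M.noise w i a j coin β c g Q Q' x n ω) atTop (𝓝 l) := by
  -- For fixed `s` the noise is a predictable weight times a martingale difference bounded by 1.
  have hterm : ∀ x s, ∀ᵐ ω ∂μ, ∃ l, Tendsto (fun N => ∑ n ∈ Finset.range N,
      effStep i a β x n ω * (M.target w (g n ω) (Q' n ω) x s - Q n ω x)
        * M.centredOutcome i a j coin c s n ω) atTop (𝓝 l) := by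
    intro x s
    have hpm : ∀ n, Measurable[ℱ n] fun ω => 1 / 2 * M.p (i n ω) (a n ω) s := fun n =>
      measurable_p_sampled (hi n) (ha n) s
    have him : ∀ n, Measurable[ℱ (n + 1)]
        (Set.indicator {ω | coin n ω = c ∧ j n ω = s} (fun _ => (1 : ℝ))) := fun n =>
      measurable_const.indicator (measurableSet_outcome (hj n) (hcoin n) c s)
    have hp01 : ∀ n ω, 0 ≤ 1 / 2 * M.p (i n ω) (a n ω) s ∧ 1 / 2 * M.p (i n ω) (a n ω) s ≤ 1 :=
      fun n ω => by
        have h1 := M.p_nonneg (i n ω) (a n ω) s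
        have h2 := M.p_le_one (i n ω) (a n ω) s
        constructor <;> linarith
    have hi01 : ∀ n ω, 0 ≤ Set.indicator {ω | coin n ω = c ∧ j n ω = s} (fun _ => (1 : ℝ)) ω ∧
        Set.indicator {ω | coin n ω = c ∧ j n ω = s} (fun _ => (1 : ℝ)) ω ≤ 1 := fun n ω => by
      rw [Set.indicator_apply]; split_ifs <;> norm_num
    refine ae_tendsto_sum_of_summable_sq (ℱ := ℱ) (fun n => ?_) (fun n => ?_) (fun n ω => ?_)
      (fun n => ?_) ?_
    · exact (measurable_effStep (hi n) (ha n) (hβ n) x).mul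
        ((measurable_target (hQ' n) (hg n) x s).sub ((measurable_pi_apply x).comp (hQ n)))
    · exact (him n).sub ((hpm n).mono (ℱ.mono n.le_succ) le_rfl)
    · have h1 := hp01 n ω
      have h2 := hi01 n ω
      exact abs_le.2 ⟨by unfold FiniteMDP.centredOutcome; linarith,
        by unfold FiniteMDP.centredOutcome; linarith⟩
    · have hpi : Integrable (fun ω => 1 / 2 * M.p (i n ω) (a n ω) s) μ :=
        Integrable.of_bound ((hpm n).mono (ℱ.le n) le_rfl).aestronglyMeasurable 1
          (Eventually.of_forall fun ω => by
            rw [Real.norm_eq_abs, abs_of_nonneg (hp01 n ω).1]; exact (hp01 n ω).2)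
      have hii : Integrable (Set.indicator {ω | coin n ω = c ∧ j n ω = s} (fun _ => (1 : ℝ))) μ :=
        Integrable.of_bound ((him n).mono (ℱ.le _) le_rfl).aestronglyMeasurable 1
          (Eventually.of_forall fun ω => by
            rw [Real.norm_eq_abs, abs_of_nonneg (hi01 n ω).1]; exact (hi01 n ω).2)
      have hpe := condExp_of_stronglyMeasurable (ℱ.le n) (hpm n).stronglyMeasurable hpi
      filter_upwards [condExp_sub hii hpi (ℱ n), hlaw n s] with ω h1 h2
      change (μ[Set.indicator {ω | coin n ω = c ∧ j n ω = s} (fun _ => (1 : ℝ))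
        - (fun ω => 1 / 2 * M.p (i n ω) (a n ω) s) | ℱ n]) ω = 0
      rw [h1, hpe, Pi.sub_apply, h2, sub_self]
    · filter_upwards [hB, hsq] with ω hBω hsqω
      -- `K` bounds `|target - Q|` on tables of norm at most `B`, so the squared weights are at most
      -- `K²` times the squared steps.
      set K : ℝ := |w| * (|M.r x.1 x.2 s| + |M.γ| * B) + |1 - w| * B + B
      refine Summable.of_nonneg_of_le (fun n => sq_nonneg _) (fun n => ?_)
        ((hsqω x).mul_right (K ^ 2))
      rw [mul_pow]
      refine mul_le_mul_of_nonneg_left (sq_le_sq' ?_ ?_) (sq_nonneg _)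
      all_goals
        have hb : ∀ y, |Q' n ω y| ≤ B := fun y => (norm_le_pi_norm (Q' n ω) y).trans (hBω n).2
        have hK : |M.target w (g n ω) (Q' n ω) x s - Q n ω x| ≤ K := by
          refine (abs_sub _ _).trans (add_le_add ?_ ((norm_le_pi_norm (Q n ω) x).trans (hBω n).1))
          refine (abs_add_le _ _).trans ?_
          rw [abs_mul, abs_mul]
          have h1 := abs_add_le (M.r x.1 x.2 s) (M.γ * Q' n ω (s, g n ω s))
          rw [abs_mul] at h1
          have h2 := mul_le_mul_of_nonneg_left (hb (s, g n ω s)) (abs_nonneg M.γ)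
          have h3 := hb (x.1, g n ω x.1)
          gcongr
          linarith
        linarith [(abs_le.1 hK).1, (abs_le.1 hK).2]
  filter_upwards [ae_all_iff.2 fun x => ae_all_iff.2 (hterm x)] with ω h x
  choose l hl using h x
  refine ⟨∑ s, l s, (tendsto_finsetSum Finset.univ fun s _ => hl s).congr fun N => ?_⟩
  rw [Finset.sum_comm]
  rfl

end Table

/-! ### The two coupled tables. -/

section Algorithm

variable {S A Ω : Type*} [Fintype S] [DecidableEq S] [MeasurableSpace S]
  [DecidableEq A] [MeasurableSpace A] {mΩ : MeasurableSpace Ω} {μ : Measure Ω} {ℱ : Filtration ℕ mΩ}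
  {M : FiniteMDP S A} {w : ℝ} {σ : Selector}
  {i : ℕ → Ω → S} {a : ℕ → Ω → A} {j : ℕ → Ω → S} {coin : ℕ → Ω → Bool}
  {β : ℕ → Ω → S × A → ℝ} {gA gB : ℕ → Ω → S → A} {QA QB : ℕ → Ω → S × A → ℝ}

theorem IsDoubleSORQLearning.followsUpdate_A
    (h : IsDoubleSORQLearning M w σ μ ℱ i a j coin β gA gB QA QB) :
    M.FollowsUpdate w i a j coin β true gA QA QB := h.update_A

theorem IsDoubleSORQLearning.followsUpdate_B
    (h : IsDoubleSORQLearning M w σ μ ℱ i a j coin β gA gB QA QB) :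
    M.FollowsUpdate w i a j coin β false gB QB QA := fun n ω => by
  rw [h.update_B n ω]
  cases coin n ω <;> simp

/-- Pathwise convergence: on a path along which the tables are bounded, the step sizes are
admissible and the accumulated noises converge, both tables tend to the fixed point. -/
theorem IsDoubleSORQLearning.tendsto_of_noise_summable [Nonempty S] [Fintype A] [Nonempty A]
    (h : IsDoubleSORQLearning M w σ μ ℱ i a j coin β gA gB QA QB)
    (hw : 0 < w) (hw_le : w ≤ M.wStar) {Qstar : S × A → ℝ}
    (hfix : Function.IsFixedPt (M.sorOp w) Qstar) {B : ℝ} {ω : Ω}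
    (hB : ∀ n, ‖QA n ω‖ ≤ B ∧ ‖QB n ω‖ ≤ B)
    (hβ : ∀ n x, 0 ≤ β n ω x ∧ β n ω x ≤ 1)
    (hsum : ∀ x, Tendsto (fun N => ∑ n ∈ Finset.range N, effStep i a β x n ω) atTop atTop)
    (hA : ∀ x, ∃ l, Tendsto (fun N => ∑ n ∈ Finset.range N,
      M.noise w i a j coin β true gA QA QB x n ω) atTop (𝓝 l))
    (hB' : ∀ x, ∃ l, Tendsto (fun N => ∑ n ∈ Finset.range N,
      M.noise w i a j coin β false gB QB QA x n ω) atTop (𝓝 l)) :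
    Tendsto (fun n => QA n ω) atTop (𝓝 Qstar) ∧ Tendsto (fun n => QB n ω) atTop (𝓝 Qstar) := by
  obtain ⟨hκ0, hκ1⟩ := M.contraction_factor hw hw_le
  have hα : ∀ n x, 0 ≤ effStep i a β x n ω / 2 ∧ effStep i a β x n ω / 2 ≤ 1 := fun n x => by
    have := hβ n x
    unfold effStep
    split_ifs <;> constructor <;> linarith
  have hαsum : ∀ x, Tendsto (fun N => ∑ n ∈ Finset.range N, effStep i a β x n ω / 2)
      atTop atTop := fun x => by
    simp only [← Finset.sum_div]
    exact (hsum x).atTop_div_const two_pos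
  -- The mean rewards cancel in the difference, so the contraction is exact: `c = 0`.
  have hdiff : Tendsto (fun n => QA n ω - QB n ω) atTop (𝓝 0) := by
    refine tendsto_zero_of_contracting_relaxation (κ := 1 - w * (1 - M.γ)) (B := B + B)
      (α := fun n x => effStep i a β x n ω / 2) (c := fun _ => 0)
      (F := fun n x => ∑ s, M.weight w x s * (QB n ω (s, gA n ω s) - QA n ω (s, gB n ω s)))
      (u := fun n x => M.noise w i a j coin β true gA QA QB x n ω
        - M.noise w i a j coin β false gB QB QA x n ω)
      hκ0 hκ1 hα hαsum ?_ ?_ ?_ tendsto_const_nhds ?_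
    · intro n x
      simp only [Pi.sub_apply, mul_sub, Finset.sum_sub_distrib, h.followsUpdate_A.relaxation n ω x,
        h.followsUpdate_B.relaxation n ω x]
      ring
    · intro x
      obtain ⟨l, hl⟩ := hA x
      obtain ⟨l', hl'⟩ := hB' x
      exact ⟨l - l', by simpa only [Finset.sum_sub_distrib] using hl.sub hl'⟩
    · intro n x
      rw [add_zero]
      exact M.abs_sum_weight_mul_le hw hw_le x fun s =>
        abs_cross_evaluation_le (h.greedy_A n ω) (h.greedy_B n ω) s
    · exact fun n => (norm_sub_le _ _).trans (add_le_add (hB n).1 (hB n).2)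
  -- Here `QB` is evaluated where `QA` is maximal; replacing it by `QA` costs `‖QA - QB‖`, which
  -- tends to zero by `hdiff` and becomes `c`.
  have herr : Tendsto (fun n => QA n ω - Qstar) atTop (𝓝 0) := by
    refine tendsto_zero_of_contracting_relaxation (κ := 1 - w * (1 - M.γ)) (B := B + ‖Qstar‖)
      (α := fun n x => effStep i a β x n ω / 2)
      (c := fun n => (1 - w * (1 - M.γ)) * ‖QA n ω - QB n ω‖)
      (F := fun n x => ∑ s, M.weight w x s * (QB n ω (s, gA n ω s) - maxOp Qstar s))
      (u := fun n x => M.noise w i a j coin β true gA QA QB x n ω)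
      hκ0 hκ1 hα hαsum ?_ hA ?_ ?_ ?_
    · intro n x
      have hx : Qstar x = w * M.meanReward x.1 x.2 + ∑ s, M.weight w x s * maxOp Qstar s := by
        rw [← M.sorOp_eq, hfix.eq]
      simp only [Pi.sub_apply, mul_sub, Finset.sum_sub_distrib, h.followsUpdate_A.relaxation n ω x]
      linear_combination (-(effStep i a β x n ω / 2)) * hx
    · intro n x
      rw [← mul_add]
      refine M.abs_sum_weight_mul_le hw hw_le x fun s => ?_
      have h1 := abs_sub_apply_le (QA n ω) (QB n ω) (s, gA n ω s)
      have h2 := abs_maxOp_sub_le (QA n ω) Qstar s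
      rw [(h.greedy_A n ω).maxOp_eq s] at h2
      rw [abs_sub_comm] at h1
      linarith [abs_sub_le (QB n ω (s, gA n ω s)) (QA n ω (s, gA n ω s)) (maxOp Qstar s)]
    · simpa using hdiff.norm.const_mul (1 - w * (1 - M.γ))
    · exact fun n => (norm_sub_le _ _).trans (add_le_add (hB n).1 le_rfl)
  have hQA : Tendsto (fun n => QA n ω) atTop (𝓝 Qstar) := tendsto_sub_nhds_zero_iff.1 herr
  exact ⟨hQA, by simpa using hQA.sub hdiff⟩

variable [DiscreteMeasurableSpace S] [Fintype A] [DiscreteMeasurableSpace A]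

theorem FiniteMDP.FollowsUpdate.measurable_succ {c : Bool} {g : ℕ → Ω → S → A}
    {Q Q' : ℕ → Ω → S × A → ℝ} (h : M.FollowsUpdate w i a j coin β c g Q Q') {n : ℕ}
    (hi : Measurable[ℱ n] (i n)) (ha : Measurable[ℱ n] (a n)) (hβ : Measurable[ℱ n] (β n))
    (hg : Measurable[ℱ n] (g n)) (hj : Measurable[ℱ (n + 1)] (j n))
    (hcoin : Measurable[ℱ (n + 1)] (coin n))
    (hQ : Measurable[ℱ n] (Q n)) (hQ' : Measurable[ℱ n] (Q' n)) :
    Measurable[ℱ (n + 1)] (Q (n + 1)) := by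
  have hle : ℱ n ≤ ℱ (n + 1) := ℱ.mono n.le_succ
  refine @measurable_pi_lambda _ _ _ (ℱ (n + 1)) _ _ fun x => ?_
  simp only [h.entry n _ x]
  refine (((measurable_pi_apply x).comp hQ).mono hle le_rfl).add
    (Finset.measurable_sum _ fun s _ => ?_)
  exact (((measurable_effStep hi ha hβ x).mul
    ((measurable_target hQ' hg x s).sub ((measurable_pi_apply x).comp hQ))).mono hle le_rfl).mul
      (measurable_const.indicator (measurableSet_outcome hj hcoin c s))

/-- Adaptedness has to be proved for both tables at once, since each update reads the other table.
-/
theorem IsDoubleSORQLearning.measurable_tables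
    (h : IsDoubleSORQLearning M w σ μ ℱ i a j coin β gA gB QA QB) (n : ℕ) :
    Measurable[ℱ n] (QA n) ∧ Measurable[ℱ n] (QB n) := by
  induction n with
  | zero => exact ⟨h.measurable_QA_zero, h.measurable_QB_zero⟩
  | succ n ih =>
    exact ⟨h.followsUpdate_A.measurable_succ (h.measurable_state n) (h.measurable_action n)
        (h.measurable_step n) (h.measurable_gA n) (h.measurable_next n) (h.measurable_coin n)
        ih.1 ih.2,
      h.followsUpdate_B.measurable_succ (h.measurable_state n) (h.measurable_action n)
        (h.measurable_step n) (h.measurable_gB n) (h.measurable_next n) (h.measurable_coin n)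
        ih.2 ih.1⟩

end Algorithm

end DoubleSOR

/-! ### Assembly on the almost sure event. -/

theorem mainTheorem2 {S A Ω : Type*}
    [Fintype S] [Nonempty S] [DecidableEq S] [MeasurableSpace S] [DiscreteMeasurableSpace S]
    [Fintype A] [Nonempty A] [DecidableEq A] [MeasurableSpace A] [DiscreteMeasurableSpace A]
    {mΩ : MeasurableSpace Ω} (μ : Measure Ω) [IsProbabilityMeasure μ] (ℱ : Filtration ℕ mΩ)
    (M : DoubleSOR.FiniteMDP S A) (w : ℝ) (hw_pos : 0 < w) (hw_le : w ≤ M.wStar)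
    (σ : DoubleSOR.Selector)
    (i : ℕ → Ω → S) (a : ℕ → Ω → A) (j : ℕ → Ω → S) (coin : ℕ → Ω → Bool)
    (β : ℕ → Ω → S × A → ℝ) (gA gB : ℕ → Ω → S → A) (QA QB : ℕ → Ω → S × A → ℝ)
    (hQ : DoubleSOR.IsDoubleSORQLearning M w σ μ ℱ i a j coin β gA gB QA QB)
    -- both tables are uniformly bounded
    (B : ℝ) (hB : ∀ᵐ ω ∂μ, ∀ n, ‖QA n ω‖ ≤ B ∧ ‖QB n ω‖ ≤ B)
    -- every state-action pair is sampled infinitely often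
    (hsample : ∀ᵐ ω ∂μ, ∀ x : S × A, ∃ᶠ n in atTop, (i n ω, a n ω) = x)
    -- step-size conditions
    (hβ : ∀ᵐ ω ∂μ, ∀ n x, 0 ≤ β n ω x ∧ β n ω x ≤ 1)
    (hβ_sum : ∀ᵐ ω ∂μ, ∀ x,
      Tendsto (fun N => ∑ n ∈ Finset.range N, DoubleSOR.effStep i a β x n ω) atTop atTop)
    (hβ_sq : ∀ᵐ ω ∂μ, ∀ x, Summable (fun n => DoubleSOR.effStep i a β x n ω ^ 2)) :
    ∃ Qstar : S × A → ℝ,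
      (Function.IsFixedPt (M.sorOp w) Qstar ∧
        ∀ Q, Function.IsFixedPt (M.sorOp w) Q → Q = Qstar) ∧
      ∀ᵐ ω ∂μ, Tendsto (fun n => QA n ω) atTop (𝓝 Qstar) ∧
        Tendsto (fun n => QB n ω) atTop (𝓝 Qstar) := by
  obtain ⟨Qstar, hfix, huniq⟩ := M.exists_unique_fixedPt_sorOp hw_pos hw_le
  refine ⟨Qstar, ⟨hfix, huniq⟩, ?_⟩
  have hmeas := hQ.measurable_tables
  have hA := DoubleSOR.ae_tendsto_sum_noise (M := M) (w := w) (c := true) (g := gA) (μ := μ)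
    hQ.measurable_state hQ.measurable_action hQ.measurable_step hQ.measurable_gA
    hQ.measurable_next hQ.measurable_coin (fun n => (hmeas n).1) (fun n => (hmeas n).2)
    (fun n => hQ.cond_law n true) hB hβ_sq
  have hB' := DoubleSOR.ae_tendsto_sum_noise (M := M) (w := w) (c := false) (g := gB) (μ := μ)
    hQ.measurable_state hQ.measurable_action hQ.measurable_step hQ.measurable_gB
    hQ.measurable_next hQ.measurable_coin (fun n => (hmeas n).2) (fun n => (hmeas n).1)
    (fun n => hQ.cond_law n false) (hB.mono fun ω h n => (h n).symm) hβ_sq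
  filter_upwards [hA, hB', hB, hβ, hβ_sum] with ω h1 h2 h3 h4 h5
  exact hQ.tendsto_of_noise_summable hw_pos hw_le hfix h3 h4 h5 h1 h2
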